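/- Let $c\in\mathbb{R}\setminus\{0\}$ and let $n>0$ be a real number such that $n>c$ if $c>0$, and $n=-cl$ for some $l\in\mathbb{N}$ if $c<0$. Let $I_c=[0,-\tfrac1c]$ if $c<0$ and $I_c=[0,+\infty)$ if $c>0$. For real $\alpha$ put $\binom{\alpha}{0}=1$ and $\binom{\alpha}{k}=\frac{\alpha(\alpha-1)\cdots(\alpha-k+1)}{k!}$ for $k\geq 1$. For $m>0$, an integer $k\ge 0$ and $x\in I_c$ let $$p_{m,k}^{[c]}(x)=(-1)^k\binom{-m/c}{k}(cx)^k(1+cx)^{-\frac mc-k},\qquad S_{m,c}(x)=\sum_{k=0}^\infty\left(p_{m,k}^{[c]}(x)\right)^2,$$ where, if $c<0$ and $x=-\tfrac1c$, we read $0^0=1$ and terms with $\binom{-m/c}{k}=0$ are $0$. Then for every $x\in I_c$ the series $S_{n,c}(x)$ and $S_{n-c,c}(x)$ converge, and $$S_{n-c,c}(x)\ \geq\ \bigl(1+2cx(1+cx)\bigr)\,S_{n,c}(x)\quad\text{if } c<0,$$ $$S_{n-c,c}(x)\ \leq\ \bigl(1+2cx(1+cx)\bigr)\,S_{n,c}(x)\quad\text{if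 } c>0.$$ -/

import Mathlib

namespace IndexOfCoincidence

/-- The generalized binomial coefficient `α (α - 1) ⋯ (α - k + 1) / k!`, equal to `1` for
`k = 0`. -/
noncomputable def binom (α : ℝ) (k : ℕ) : ℝ :=
  (∏ i ∈ Finset.range k, (α - (i : ℝ))) / (k.factorial : ℝ)

/-- The domain `I_c`: `[0, -1/c]` if `c < 0` and `[0, ∞)` if `c ≥ 0`. -/
noncomputable def domain (c : ℝ) : Set ℝ :=
  if c < 0 then Set.Icc 0 (-1 / c) else Set.Ici 0

/-- The weights `p_{n,k}^{[c]}(x)`, with the Poisson weights at `c = 0`.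
If `c < 0`, `n = -c l` and `x = -1/c`, then `1 + c x = 0` and the power has exponent `l - k`:
it is `0 ^ 0 = 1` for `k = l`, and for `k > l` the binomial coefficient vanishes. -/
noncomputable def p (n c : ℝ) (k : ℕ) (x : ℝ) : ℝ :=
  if c = 0 then (n * x) ^ k / (k.factorial : ℝ) * Real.exp (-(n * x))
  else (-1) ^ k * binom (-n / c) k * (c * x) ^ k * (1 + c * x) ^ (-n / c - (k : ℝ))

/-- The index of coincidence `S_{n,c}(x) = ∑_{k ≥ 0} (p_{n,k}^{[c]}(x))²`. -/
noncomputable def S (n c x : ℝ) : ℝ := ∑' k : ℕ, (p n c k x) ^ 2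

/-- The admissible parameters: `n > 0`, with `n > c` if `c ≥ 0`, and `n = -c l` for a natural
number `l` if `c < 0` (so that `l ≥ 1`). -/
def Admissible (n c : ℝ) : Prop :=
  0 < n ∧ (0 ≤ c → c < n) ∧ (c < 0 → ∃ l : ℕ, n = -c * (l : ℝ))

end IndexOfCoincidence

namespace IndexOfCoincidence

open Filter Topology

/-! Pascal's rule turns the shift from `n` to `n - c` into a two-term recurrence for the weights
(`p_sub_succ`), with coefficients `A = 1 + c x` and `B = c x`. Squaring and summing
(`hasSum_sq_of_recurrence`) gives `A ^ 2 + B ^ 2 = 1 + 2 c x (1 + c x)` times `S n c x`, minus `2 A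
B ∑ p_k p_{k+1}`. The weights are nonnegative and `A ≥ 0`, so the correction has the sign of `c x`,
which decides the direction of the inequality. -/

lemma binom_zero (α : ℝ) : binom α 0 = 1 := by simp [binom]

lemma binom_succ (α : ℝ) (k : ℕ) :
    binom α (k + 1) = binom α k * ((α - k) / (k + 1)) := by
  have h : ((k : ℝ) + 1) ≠ 0 := by positivity
  have h' : (k.factorial : ℝ) ≠ 0 := by positivity
  rw [binom, binom, Finset.prod_range_succ, Nat.factorial_succ]
  push_cast
  field_simp

lemma binom_add_one_succ (α : ℝ) (k : ℕ) :
    binom (α + 1) (k + 1) = binom α (k + 1) + binom α k := by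
  induction k with
  | zero => simp [binom]
  | succ k ih =>
    have h : ((k : ℝ) + 1) ≠ 0 := by positivity
    have h' : ((k : ℝ) + 1 + 1) ≠ 0 := by positivity
    rw [binom_succ (α + 1) (k + 1), ih, binom_succ α (k + 1), binom_succ α k]
    push_cast
    field_simp
    ring

lemma binom_natCast_eq_zero {l k : ℕ} (hk : l < k) : binom l k = 0 := by
  rw [binom, Finset.prod_eq_zero (Finset.mem_range.2 hk) (sub_self _), zero_div]

lemma binom_natCast_nonneg (l k : ℕ) : 0 ≤ binom l k := by
  rcases le_or_gt k l with hk | hk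
  · refine div_nonneg (Finset.prod_nonneg fun i hi => ?_) (by positivity)
    have : (i : ℝ) ≤ l := by exact_mod_cast ((Finset.mem_range.1 hi).le.trans hk)
    linarith
  · exact (binom_natCast_eq_zero hk).ge

lemma neg_one_pow_mul_binom_nonneg {α : ℝ} (hα : α ≤ 0) (k : ℕ) :
    0 ≤ (-1) ^ k * binom α k := by
  induction k with
  | zero => simp [binom_zero]
  | succ k ih =>
    have h : (-1) ^ (k + 1) * binom α (k + 1)
        = ((-1) ^ k * binom α k) * ((k - α) / (k + 1)) := by
      rw [binom_succ]; ring
    rw [h]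
    have hk : (0 : ℝ) ≤ k := k.cast_nonneg
    exact mul_nonneg ih (div_nonneg (by linarith) (by linarith))

lemma p_sub_zero {n c x : ℝ} (hc : c ≠ 0) (hx : 0 ≤ 1 + c * x) (hn : -n / c + 1 ≠ 0) :
    p (n - c) c 0 x = (1 + c * x) * p n c 0 x := by
  have hα : -(n - c) / c = -n / c + 1 := by field_simp; ring
  simp only [p, if_neg hc, hα, binom_zero]
  rw [Nat.cast_zero, sub_zero, sub_zero, Real.rpow_add_one' hx hn]
  ring

lemma p_sub_succ {n c x : ℝ} (hc : c ≠ 0) (hx : 0 ≤ 1 + c * x) (k : ℕ) :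
    p (n - c) c (k + 1) x
      = (1 + c * x) * p n c (k + 1) x - c * x * p n c k x := by
  have hα : -(n - c) / c = -n / c + 1 := by field_simp; ring
  simp only [p, if_neg hc, hα, binom_add_one_succ]
  generalize -n / c = α
  have he : α + 1 - ((k + 1 : ℕ) : ℝ) = α - k := by push_cast; ring
  have key : binom α (k + 1) * (1 + c * x) ^ (α - k)
      = (1 + c * x) * (binom α (k + 1) * (1 + c * x) ^ (α - ((k + 1 : ℕ) : ℝ))) := by
    -- The base `1 + c x` may vanish, so lowering the exponent requires `α - k ≠ 0`; when `α = k`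
    -- the factor `binom α (k + 1)` is zero.
    by_cases h : α - k = 0
    · rw [binom_succ, h]; simp
    · have h' : α - k = α - ((k + 1 : ℕ) : ℝ) + 1 := by push_cast; ring
      rw [h', Real.rpow_add_one' hx (h' ▸ h)]
      ring
  rw [he]
  linear_combination (-1) ^ (k + 1) * (c * x) ^ (k + 1) * key

lemma p_succ_of_pos {n c x : ℝ} (hc : c ≠ 0) (hx : 0 < 1 + c * x) (k : ℕ) :
    p n c (k + 1) x
      = (1 + (n / c - 1) * (1 / ((k : ℝ) + 1))) * (c * x / (1 + c * x)) * p n c k x := by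
  have hα : -n / c = -(n / c) := by ring
  simp only [p, if_neg hc, hα, binom_succ]
  generalize n / c = a
  have he : -a - ((k + 1 : ℕ) : ℝ) = -a - k - 1 := by push_cast; ring
  have h1 : (k : ℝ) + 1 ≠ 0 := by positivity
  rw [he, Real.rpow_sub_one hx.ne']
  field_simp
  ring

/-- Ratio test: consecutive squares have ratio tending to `q ^ 2`, where `q = c x / (1 + c x) < 1`.
-/
lemma summable_p_sq_of_pos {n c x : ℝ} (hc : 0 < c) (hx : 0 ≤ x) :
    Summable fun k : ℕ => p n c k x ^ 2 := by
  have hy : 0 ≤ c * x := by positivity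
  have hy' : 0 < 1 + c * x := by linarith
  set q := c * x / (1 + c * x) with hq
  have hq0 : 0 ≤ q := by positivity
  have hq1 : q < 1 := by rw [hq, div_lt_one hy']; linarith
  have ht : Tendsto (fun k : ℕ => ((1 + (n / c - 1) * (1 / ((k : ℝ) + 1))) * q) ^ 2) atTop
      (𝓝 (q ^ 2)) := by
    have := (((tendsto_one_div_add_atTop_nhds_zero_nat (𝕜 := ℝ)).const_mul
      (n / c - 1)).const_add 1).mul_const q |>.pow 2
    simpa using this
  obtain ⟨r, hqr, hr⟩ := exists_between (pow_lt_one₀ hq0 hq1 two_ne_zero)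
  refine summable_of_ratio_norm_eventually_le hr ?_
  filter_upwards [ht.eventually (gt_mem_nhds hqr)] with k hk
  rw [p_succ_of_pos hc.ne' hy' k, Real.norm_of_nonneg (sq_nonneg _),
    Real.norm_of_nonneg (sq_nonneg _), mul_pow]
  exact mul_le_mul_of_nonneg_right hk.le (sq_nonneg _)

lemma p_nonneg_of_pos {n c x : ℝ} (hn : 0 ≤ n) (hc : 0 < c) (hx : 0 ≤ x) (k : ℕ) :
    0 ≤ p n c k x := by
  have hα : -n / c ≤ 0 := div_nonpos_of_nonpos_of_nonneg (by linarith) hc.le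
  have hy : 0 ≤ c * x := by positivity
  rw [p, if_neg hc.ne']
  exact mul_nonneg (mul_nonneg (neg_one_pow_mul_binom_nonneg hα k) (pow_nonneg hy k))
    (Real.rpow_nonneg (by linarith) _)

lemma p_nonneg_of_neg {n c x : ℝ} (hc : c < 0) {l : ℕ} (hl : -n / c = l)
    (hx : 0 ≤ x) (hx' : 0 ≤ 1 + c * x) (k : ℕ) : 0 ≤ p n c k x := by
  have hy : 0 ≤ -(c * x) := by
    have := mul_nonneg (neg_nonneg.2 hc.le) hx
    linarith
  -- For `c < 0` the sign is absorbed by `c x ≤ 0`; for `c > 0` it is absorbed by the binomial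
  -- coefficient.
  have h : (-1) ^ k * binom (-n / c) k * (c * x) ^ k = binom l k * (-(c * x)) ^ k := by
    rw [hl, neg_pow (c * x)]; ring
  rw [p, if_neg hc.ne, h]
  exact mul_nonneg (mul_nonneg (binom_natCast_nonneg l k) (pow_nonneg hy k))
    (Real.rpow_nonneg hx' _)

lemma summable_p_sq_of_neg {n c x : ℝ} (hc : c < 0) {l : ℕ} (hl : -n / c = l) :
    Summable fun k : ℕ => p n c k x ^ 2 := by
  refine summable_of_ne_finset_zero (s := Finset.range (l + 1)) fun k hk => ?_
  have hk' : l < k := by simpa [Nat.lt_succ_iff] using hk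
  rw [p, if_neg hc.ne, hl, binom_natCast_eq_zero hk']
  simp

/-- If `b 0 = A * a 0` and `b (k + 1) = A * a (k + 1) - B * a k`, then the sums of squares of
`a` and `b` differ by a multiple of the autocorrelation `∑ k, a k * a (k + 1)`. -/
lemma hasSum_sq_of_recurrence {a b : ℕ → ℝ} {A B : ℝ} (ha : Summable fun k => a k ^ 2)
    (h0 : b 0 = A * a 0) (hs : ∀ k, b (k + 1) = A * a (k + 1) - B * a k) :
    HasSum (fun k => b k ^ 2)
      ((A ^ 2 + B ^ 2) * ∑' k, a k ^ 2 - 2 * A * B * ∑' k, a k * a (k + 1)) := by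
  have ha' : Summable fun k => a (k + 1) ^ 2 := (summable_nat_add_iff 1).2 ha
  have hcross : Summable fun k => a k * a (k + 1) := by
    refine Summable.of_norm_bounded (ha.add ha') fun k => ?_
    rw [Real.norm_eq_abs, abs_le]
    constructor <;> nlinarith [sq_nonneg (a k + a (k + 1)), sq_nonneg (a k - a (k + 1)),
      sq_nonneg (a k), sq_nonneg (a (k + 1))]
  -- The shifted sum of the `A ^ 2` terms misses `a 0 ^ 2`; the term `b 0 ^ 2 = A ^ 2 * a 0 ^ 2`
  -- restores it.
  rw [← hasSum_nat_add_iff' 1]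
  have h := ((ha'.hasSum.mul_left (A ^ 2)).add (ha.hasSum.mul_left (B ^ 2))).sub
    (hcross.hasSum.mul_left (2 * A * B))
  convert h using 1
  · ext k
    rw [hs]; ring
  · rw [ha.tsum_eq_zero_add, Finset.sum_range_one, h0]
    ring

lemma hasSum_p_sub_sq {n c x : ℝ} (hc : c ≠ 0) (hx : 0 ≤ 1 + c * x) (hn : -n / c + 1 ≠ 0)
    (hs : Summable fun k : ℕ => p n c k x ^ 2) :
    HasSum (fun k : ℕ => p (n - c) c k x ^ 2)
      ((1 + 2 * c * x * (1 + c * x)) * S n c x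
        - 2 * (c * x) * (1 + c * x) * ∑' k : ℕ, p n c k x * p n c (k + 1) x) := by
  convert hasSum_sq_of_recurrence (b := fun k => p (n - c) c k x) hs (p_sub_zero hc hx hn)
    (p_sub_succ hc hx) using 1
  rw [S]
  ring

end IndexOfCoincidence

theorem theorem4p1 (n c x : ℝ) (hnc : IndexOfCoincidence.Admissible n c)
    (hx : x ∈ IndexOfCoincidence.domain c) :
    (c < 0 →
      Summable (fun k : ℕ => (IndexOfCoincidence.p n c k x) ^ 2) ∧
      Summable (fun k : ℕ => (IndexOfCoincidence.p (n - c) c k x) ^ 2) ∧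
      IndexOfCoincidence.S (n - c) c x ≥
        (1 + 2 * c * x * (1 + c * x)) * IndexOfCoincidence.S n c x) ∧
    (0 < c →
      Summable (fun k : ℕ => (IndexOfCoincidence.p n c k x) ^ 2) ∧
      Summable (fun k : ℕ => (IndexOfCoincidence.p (n - c) c k x) ^ 2) ∧
      IndexOfCoincidence.S (n - c) c x ≤
        (1 + 2 * c * x * (1 + c * x)) * IndexOfCoincidence.S n c x) := by
  have hneg : c < 0 → x ∈ Set.Icc 0 (-1 / c) := fun hc => by
    simpa [IndexOfCoincidence.domain, hc] using hx
  have hpos : 0 < c → 0 ≤ x := fun hc => by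
    simpa [IndexOfCoincidence.domain, hc.not_gt] using hx
  obtain ⟨hn, hcn, hl⟩ := hnc
  constructor
  · intro hc
    obtain ⟨l, hl⟩ := hl hc
    obtain ⟨hx0, hx1⟩ := hneg hc
    have hl' : -n / c = l := by rw [hl]; field_simp [hc.ne]
    have hy : 0 ≤ 1 + c * x := by
      have := (le_div_iff_of_neg hc).1 hx1
      linarith
    have hs := IndexOfCoincidence.summable_p_sq_of_neg (x := x) hc hl'
    have hsum := IndexOfCoincidence.hasSum_p_sub_sq hc.ne hy (by rw [hl']; positivity) hs
    refine ⟨hs, hsum.summable, ?_⟩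
    have hp := IndexOfCoincidence.p_nonneg_of_neg hc hl' hx0 hy
    have hcross : 0 ≤ ∑' k : ℕ, IndexOfCoincidence.p n c k x * IndexOfCoincidence.p n c (k + 1) x :=
      tsum_nonneg fun k => mul_nonneg (hp k) (hp (k + 1))
    have hcx : c * x ≤ 0 := mul_nonpos_of_nonpos_of_nonneg hc.le hx0
    have := mul_nonpos_of_nonpos_of_nonneg (mul_nonpos_of_nonpos_of_nonneg hcx hy) hcross
    rw [IndexOfCoincidence.S.eq_1 (n - c), hsum.tsum_eq]
    linarith
  · intro hc
    have hx0 := hpos hc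
    have hcx : 0 ≤ c * x := mul_nonneg hc.le hx0
    have hy : 0 ≤ 1 + c * x := by linarith
    -- With `n > c` the exponent `-n / c + 1` is negative, hence nonzero.
    have ha : -n / c + 1 ≠ 0 := by
      have : 1 < n / c := (one_lt_div hc).2 (hcn hc.le)
      rw [neg_div]
      linarith
    have hs := IndexOfCoincidence.summable_p_sq_of_pos (n := n) hc hx0
    have hsum := IndexOfCoincidence.hasSum_p_sub_sq hc.ne' hy ha hs
    refine ⟨hs, hsum.summable, ?_⟩
    have hp := IndexOfCoincidence.p_nonneg_of_pos hn.le hc hx0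
    have hcross : 0 ≤ ∑' k : ℕ, IndexOfCoincidence.p n c k x * IndexOfCoincidence.p n c (k + 1) x :=
      tsum_nonneg fun k => mul_nonneg (hp k) (hp (k + 1))
    have := mul_nonneg (mul_nonneg hcx hy) hcross
    rw [IndexOfCoincidence.S.eq_1 (n - c), hsum.tsum_eq]
    linarith
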